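/- Let $K$ be a field, let $d\in\mathbb N$ and let $c\ge 2$, $\alpha\ge 2$ be integers. Put $M_{\alpha,d}=\{(u_1,\dots,u_d)\in\mathbb N^d : u_1+\cdots+u_d=\alpha\}$, let $\mathbf e_1=(\alpha,0,\dots,0),\dots,\mathbf e_d=(0,\dots,0,\alpha)$, and let $\mathbf a_1,\dots,\mathbf a_c$ be pairwise distinct elements of $M_{\alpha,d}\setminus\{\mathbf e_1,\dots,\mathbf e_d\}$. Let $S\subseteq\mathbb N^d$ be the (homogeneous simplicial affine) semigroup generated by $\mathcal A=\{\mathbf e_1,\dots,\mathbf e_d,\mathbf a_1,\dots,\mathbf a_c\}$, and let $K[S]=K[t_1^\alpha,\dots,t_d^\alpha,\mathbf t^{\mathbf a_1},\dots,\mathbf t^{\mathbf a_c}]\subseteq K[t_1,\dots,t_d]$, graded so that $\mathbf t^{\mathbf b}$ has degree $(b_1+\cdots+b_d)/\alpha$. Let $I_{\mathcal A}$ be the kernel of the $K$-algebra homomorphism $K[x_1,\dots,x_c,y_1,\dots,y_d]\to K[S]$, $x_i\mapsto\mathbf t^{\mathbf a_i}$, $y_j\mapsto t_j^\alpha$, where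 the polynomial ring has the standard grading and carries the graded reverse lexicographic order with $x_1>\cdots>x_c>y_1>\cdots>y_d$. Let $r(S)$ be the reduction number of $K[S]$ with respect to $\mathfrak q=(t_1^\alpha,\dots,t_d^\alpha)K[S]$, i.e. the least integer $n\ge 0$ with $[\mathfrak q]_{n+1}=K[S]_{n+1}$. Let $\deg K[S]$ be the multiplicity of $K[S]$, i.e. $\lim_{n\to\infty}(D-1)!\,\dim_K K[S]_n/n^{D-1}$ with $D=\dim K[S]$ the Krull dimension, and let $\operatorname{codim}K[S]=\dim K[\mathbf x,\mathbf y]-\dim K[S]$. (These numbers exist, and $D\geq 1$.) Then every element of every minimal Gröbner basis of $I_{\mathcal A}$ has degree at most $\max\{r(S)+1,\,2r(S)-1\}$, and $$\max\{r(S)+1,\,2r(S)-1\}\le\max\{2,\ 2(\deg K[S]-\operatorname{codim}K[S])-1\}.$$ -/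

import Mathlib

open MvPolynomial Filter Topology
open scoped Nat

/-! ### The (graded) reverse lexicographic order -/

section DegRevLex

/-- A copy of the exponent vectors `σ →₀ ℕ`, to be ordered reverse lexicographically. -/
def DegRevLex (σ : Type*) := σ →₀ ℕ

/-- The identity map from exponent vectors to the copy that carries the reverse lexicographic
order. -/
def toDegRevLex {σ : Type*} : (σ →₀ ℕ) ≃ DegRevLex σ := Equiv.refl _

noncomputable instance (σ : Type*) : AddCommMonoid (DegRevLex σ) :=
  toDegRevLex.symm.addCommMonoid

theorem toDegRevLex_add {σ : Type*} (u v : σ →₀ ℕ) :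
    toDegRevLex (u + v) = toDegRevLex u + toDegRevLex v := rfl

/-- Sorting key for the reverse lexicographic order: the total degree first, then, with the order
reversed, the exponents read from the last variable to the first one. -/
noncomputable def DegRevLex.key {σ : Type*} (u : DegRevLex σ) : ℕ ×ₗ (Lex (σᵒᵈ →₀ ℕ))ᵒᵈ :=
  toLex ((toDegRevLex.symm u).degree,
    OrderDual.toDual (toLex (Finsupp.equivMapDomain OrderDual.toDual (toDegRevLex.symm u))))

theorem DegRevLex.key_injective {σ : Type*} :
    Function.Injective (DegRevLex.key (σ := σ)) := by
  intro u v h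
  have h2 := congrArg (fun p => OrderDual.ofDual (ofLex p).2) h
  exact (Finsupp.equivCongrLeft (M := ℕ) (OrderDual.toDual (α := σ))).injective
    (toLex.injective h2)

noncomputable instance (σ : Type*) [LinearOrder σ] : LinearOrder (DegRevLex σ) :=
  LinearOrder.lift' DegRevLex.key DegRevLex.key_injective

/-- The usual description of the reverse lexicographic order, for variables ordered so that a
smaller index means a bigger variable: `u < v` if and only if `deg u < deg v`, or `deg u = deg v`
and `u i > v i` for the last index `i` at which `u` and `v` differ. -/
theorem toDegRevLex_lt_iff {σ : Type*} [LinearOrder σ] (u v : σ →₀ ℕ) :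
    toDegRevLex u < toDegRevLex v ↔
      u.degree < v.degree ∨
        (u.degree = v.degree ∧ ∃ i, (∀ j, i < j → u j = v j) ∧ v i < u i) := by
  change DegRevLex.key (toDegRevLex u) < DegRevLex.key (toDegRevLex v) ↔ _
  unfold DegRevLex.key
  rw [Prod.Lex.toLex_lt_toLex]
  refine or_congr Iff.rfl (and_congr Iff.rfl ?_)
  rw [OrderDual.toDual_lt_toDual, Finsupp.Lex.lt_iff]
  constructor
  · rintro ⟨i, hi, hlt⟩
    exact ⟨OrderDual.ofDual i, fun j hj => (hi (OrderDual.toDual j) hj).symm, hlt⟩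
  · rintro ⟨i, hi, hlt⟩
    exact ⟨OrderDual.toDual i, fun j hj => (hi (OrderDual.ofDual j) hj).symm, hlt⟩

instance (σ : Type*) [LinearOrder σ] : IsOrderedAddMonoid (DegRevLex σ) where
  add_le_add_left u v h w := by
    obtain ⟨u, rfl⟩ := toDegRevLex.surjective u
    obtain ⟨v, rfl⟩ := toDegRevLex.surjective v
    obtain ⟨w, rfl⟩ := toDegRevLex.surjective w
    rcases h.eq_or_lt with h | h
    · rw [h]
    · refine le_of_lt ?_
      rw [← toDegRevLex_add, ← toDegRevLex_add, toDegRevLex_lt_iff]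
      rw [toDegRevLex_lt_iff] at h
      simpa only [map_add, Finsupp.add_apply, add_lt_add_iff_right, add_left_inj] using h

theorem toDegRevLex_monotone {σ : Type*} [LinearOrder σ] :
    Monotone (toDegRevLex (σ := σ)) := by
  intro u v h
  rcases h.eq_or_lt with rfl | h
  · exact le_rfl
  · refine le_of_lt ((toDegRevLex_lt_iff u v).2 (Or.inl ?_))
    obtain ⟨w, rfl⟩ := exists_add_of_le h.le
    have hw : w ≠ 0 := by rintro rfl; simp at h
    have : w.degree ≠ 0 := fun h0 => hw ((Finsupp.degree_eq_zero_iff w).1 h0)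
    rw [map_add]; omega

instance (σ : Type*) [LinearOrder σ] [Finite σ] : WellFoundedLT (DegRevLex σ) := by
  have h := (Set.isPWO_of_wellQuasiOrderedLE (Set.univ : Set (σ →₀ ℕ))).image_of_monotone toDegRevLex_monotone
  rw [Set.image_univ_of_surjective toDegRevLex.surjective] at h
  exact ⟨Set.wellFoundedOn_univ.1 h.isWF⟩

/-- The graded reverse lexicographic order, as a monomial order. The variables are ordered so that
a smaller index means a bigger variable. -/
noncomputable def degRevLex (σ : Type*) [LinearOrder σ] [Finite σ] : MonomialOrder σ where
  syn := DegRevLex σ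
  toSyn := { toEquiv := toDegRevLex, map_add' := toDegRevLex_add }
  toSyn_monotone := toDegRevLex_monotone

end DegRevLex

/-! ### Minimal Gröbner bases -/

/-- The initial ideal of `I`, generated by the leading monomials of its nonzero elements. -/
noncomputable def initialIdeal {σ K : Type*} [Field K] (m : MonomialOrder σ)
    (I : Ideal (MvPolynomial σ K)) : Ideal (MvPolynomial σ K) :=
  Ideal.span {p | ∃ f ∈ I, f ≠ 0 ∧ p = monomial (m.degree f) 1}

/-- `G` is a minimal Gröbner basis of `I`: it consists of nonzero elements of `I` whose leading
monomials generate the initial ideal, and none of these leading monomials divides another one. -/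
def IsMinimalGroebnerBasis {σ K : Type*} [Field K] (m : MonomialOrder σ)
    (I : Ideal (MvPolynomial σ K)) (G : Set (MvPolynomial σ K)) : Prop :=
  G ⊆ I ∧ 0 ∉ G ∧
    Ideal.span {p : MvPolynomial σ K | ∃ g ∈ G, p = monomial (m.degree g) 1} = initialIdeal m I ∧
    ∀ g ∈ G, ∀ g' ∈ G, g ≠ g' → ¬ m.degree g ≤ m.degree g'

/-! ### Reduction number, multiplicity, codimension -/

/-- For a graded ideal `I` of a graded algebra `A` with components `𝒜 n`, the number `r` is the
least `n` such that `[I]_{n+1} = A_{n+1}`. -/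
def IsReductionNumber {K A : Type*} [Field K] [CommRing A] [Algebra K A]
    (𝒜 : ℕ → Submodule K A) (I : Ideal A) (r : ℕ) : Prop :=
  IsLeast {n : ℕ | I.restrictScalars K ⊓ 𝒜 (n + 1) = 𝒜 (n + 1)} r

/-- The multiplicity (degree) of a standard graded `K`-algebra `A` of positive Krull dimension
`k + 1` with components `𝒜 n` is `e`: the limit of `k! · dim_K (𝒜 n) / n ^ k` is `e`. -/
def IsMultiplicity {K A : Type*} [Field K] [CommRing A] [Algebra K A]
    (𝒜 : ℕ → Submodule K A) (e : ℕ) : Prop :=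
  ∃ k : ℕ, ringKrullDim A = (k : WithBot ℕ∞) + 1 ∧
    Tendsto (fun n : ℕ => ((k ! : ℕ) : ℝ) * (Module.finrank K (𝒜 n) : ℝ) / (n : ℝ) ^ k)
      atTop (𝓝 (e : ℝ))

/-- `A`, presented as a quotient of the finite-dimensional ring `R`, has codimension
`δ = dim R - dim A`. -/
def IsCodimension (R A : Type*) [CommRing R] [CommRing A] (δ : ℕ) : Prop :=
  ringKrullDim R = ringKrullDim A + (δ : WithBot ℕ∞)

/-! ### Simplicial toric ideals -/

section Toric

variable {c d : ℕ}

/-- The generators of `S`: the exponents `a₁, …, a_c` and `e_j = (0, …, α, …, 0)`. The index type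
is ordered with the `c` first indices before the `d` last ones. -/
noncomputable def toricGenerators (α : ℕ) (a : Fin c → Fin d →₀ ℕ) (v : Fin c ⊕ₗ Fin d) :
    Fin d →₀ ℕ :=
  Sum.elim a (fun j => Finsupp.single j α) (ofLex v)

/-- The map `K[x, y] → K[t]` with `x_i ↦ t ^ a_i` and `y_j ↦ t_j ^ α`. -/
noncomputable def toricMap (K : Type*) [Field K] (α : ℕ) (a : Fin c → Fin d →₀ ℕ) :
    MvPolynomial (Fin c ⊕ₗ Fin d) K →ₐ[K] MvPolynomial (Fin d) K :=
  aeval fun v => monomial (toricGenerators α a v) (1 : K)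

/-- The toric ideal `I_A`, the kernel of the map `K[x, y] → K[t]`. -/
noncomputable def toricIdeal (K : Type*) [Field K] (α : ℕ) (a : Fin c → Fin d →₀ ℕ) :
    Ideal (MvPolynomial (Fin c ⊕ₗ Fin d) K) :=
  RingHom.ker (toricMap K α a)

/-- The semigroup ring `K[S]`, as the subalgebra of `K[t]` generated by the monomials whose
exponents generate `S`. -/
noncomputable def semigroupRing (K : Type*) [Field K] (α : ℕ) (a : Fin c → Fin d →₀ ℕ) :
    Subalgebra K (MvPolynomial (Fin d) K) :=
  Algebra.adjoin K (Set.range fun v => monomial (toricGenerators α a v) (1 : K))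

/-- The degree `n` component of `K[S]`, in the grading where `t ^ b` has degree
`(b₁ + ⋯ + b_d) / α`. -/
noncomputable def semigroupRingPiece (K : Type*) [Field K] (α : ℕ) (a : Fin c → Fin d →₀ ℕ)
    (n : ℕ) : Submodule K (semigroupRing K α a) :=
  (homogeneousSubmodule (Fin d) K (α * n)).comap (semigroupRing K α a).val.toLinearMap

/-- The ideal `(t₁ ^ α, …, t_d ^ α)` of `K[S]`. -/
noncomputable def parameterIdeal (K : Type*) [Field K] (α : ℕ) (a : Fin c → Fin d →₀ ℕ) :
    Ideal (semigroupRing K α a) :=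
  Ideal.span {f | ∃ j : Fin d, (f : MvPolynomial (Fin d) K) = X j ^ α}

end Toric

/-! The toric ideal is spanned by binomials, so its initial monomials are the non-minimal ones in
the fibres of the exponent map. Let `u` be a minimal generator of the initial ideal and `n` the
smallest monomial of its fibre. Every monomial of degree `r + 1` has the same image as one involving
some `y`, and reverse lex makes the latter smaller than any pure `x`-monomial of that degree. Hence
the `x`-part of `n` has degree at most `r`, and either `u` is a pure `x`-monomial of degree `r + 1`
or its `x`-part has degree at most `r` too. By minimality `n` and `u` share no variable, so the
image of `yPart u` divides that of `xPart n`. Thus `yPart u` has degree at most `r`, and equality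
would make `xPart n` reducible. This gives `2r - 1` (`degree_le_of_minimal_toricReducible`).

For the second inequality, the multiplicity is the number of residues mod `α` of elements of `S`:
each residue class contributes `n ^ k / k!` asymptotically, where `d = k + 1`
(`tendsto_card_toricLevel`). The codimension is `c`. If `r > 0`, some element of degree `r` admits
no subtraction of any `e_j`. A chain of divisors of it yields one new residue in each degree `2, …,
r`, besides those of `0, a_1, …, a_c`. So `r + c` is at most the multiplicity
(`IsToricApery.degree_add_le`). -/

/-! ### Exponents of images and their degrees -/

section ToricExponent

variable {c d : ℕ}

/-- The exponent of the image in `K[t]` of the monomial with exponent `u`. -/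
noncomputable def toricExponent (α : ℕ) (a : Fin c → Fin d →₀ ℕ) :
    (Fin c ⊕ₗ Fin d →₀ ℕ) →ₗ[ℕ] (Fin d →₀ ℕ) :=
  Finsupp.linearCombination ℕ (toricGenerators α a)

/-- The part of an exponent vector that involves the variables `x` only. -/
noncomputable def xPart (u : Fin c ⊕ₗ Fin d →₀ ℕ) : Fin c ⊕ₗ Fin d →₀ ℕ :=
  u.filter fun v => (ofLex v).isLeft = true

/-- The part of an exponent vector that involves the variables `y` only. -/
noncomputable def yPart (u : Fin c ⊕ₗ Fin d →₀ ℕ) : Fin c ⊕ₗ Fin d →₀ ℕ :=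
  u.filter fun v => ¬ (ofLex v).isLeft = true

theorem xPart_add_yPart (u : Fin c ⊕ₗ Fin d →₀ ℕ) : xPart u + yPart u = u :=
  Finsupp.filter_add_filter_not _ _

theorem xPart_le (u : Fin c ⊕ₗ Fin d →₀ ℕ) : xPart u ≤ u :=
  le_self_add.trans_eq (xPart_add_yPart u)

theorem xPart_inr (u : Fin c ⊕ₗ Fin d →₀ ℕ) (j : Fin d) : xPart u (toLex (Sum.inr j)) = 0 := by
  simp [xPart]

variable (α : ℕ) (a : Fin c → Fin d →₀ ℕ)

theorem toricExponent_single_inl (i : Fin c) (n : ℕ) :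
    toricExponent α a (Finsupp.single (toLex (Sum.inl i)) n) = n • a i := by
  simp [toricExponent, toricGenerators]

theorem toricExponent_single_inr (j : Fin d) (n : ℕ) :
    toricExponent α a (Finsupp.single (toLex (Sum.inr j)) n) = n • Finsupp.single j α := by
  simp [toricExponent, toricGenerators]

theorem toricExponent_yPart_apply (u : Fin c ⊕ₗ Fin d →₀ ℕ) (j : Fin d) :
    toricExponent α a (yPart u) j = u (toLex (Sum.inr j)) * α := by
  induction u using Finsupp.induction_linear with
  | zero => rw [yPart, Finsupp.filter_zero]; simp
  | add u v hu hv =>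
    rw [yPart, Finsupp.filter_add, map_add, Finsupp.add_apply, Finsupp.add_apply, add_mul,
      ← hu, ← hv, yPart, yPart]
  | single v n =>
    obtain ⟨v, rfl⟩ := toLex.surjective v
    rcases v with i | j'
    · rw [yPart, Finsupp.filter_single_of_neg _ (by simp)]
      simp
    · rw [yPart, Finsupp.filter_single_of_pos _ (by simp), toricExponent_single_inr]
      by_cases h : j' = j
      · subst h; simp
      · rw [Finsupp.smul_apply, Finsupp.single_eq_of_ne (Ne.symm h),
          Finsupp.single_eq_of_ne (by simpa using Ne.symm h)]
        simp

variable {α a}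

theorem degree_toricExponent (ha : ∀ i, (a i).degree = α) (u : Fin c ⊕ₗ Fin d →₀ ℕ) :
    (toricExponent α a u).degree = u.degree * α := by
  induction u using Finsupp.induction_linear with
  | zero => simp
  | add u v hu hv => simp [hu, hv, add_mul]
  | single v n =>
    obtain ⟨v, rfl⟩ := toLex.surjective v
    rcases v with i | j
    · rw [toricExponent_single_inl, map_nsmul, ha]; simp
    · rw [toricExponent_single_inr, map_nsmul]; simp

theorem degree_eq_of_toricExponent_eq (hα : α ≠ 0) (ha : ∀ i, (a i).degree = α)
    {u w : Fin c ⊕ₗ Fin d →₀ ℕ} (h : toricExponent α a u = toricExponent α a w) :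
    u.degree = w.degree := by
  have := congrArg Finsupp.degree h
  rw [degree_toricExponent ha, degree_toricExponent ha] at this
  exact Nat.eq_of_mul_eq_mul_right (Nat.pos_of_ne_zero hα) this

end ToricExponent

/-! ### Properties of the reverse lexicographic order -/

section DegRevLex

variable {σ : Type*} [LinearOrder σ]

theorem toDegRevLex_add_lt_add_iff (u v w : σ →₀ ℕ) :
    toDegRevLex (u + w) < toDegRevLex (v + w) ↔ toDegRevLex u < toDegRevLex v := by
  simp only [toDegRevLex_lt_iff, map_add, Finsupp.add_apply, add_lt_add_iff_right, add_left_inj]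

theorem degree_le_of_toDegRevLex_le {u v : σ →₀ ℕ} (h : toDegRevLex u ≤ toDegRevLex v) :
    u.degree ≤ v.degree := by
  rcases h.eq_or_lt with h | h
  · rw [toDegRevLex.injective h]
  · rcases (toDegRevLex_lt_iff u v).1 h with h | h
    exacts [h.le, h.1.le]

theorem totalDegree_eq_degree_degRevLex {R : Type*} [CommSemiring R] [Finite σ]
    (f : MvPolynomial σ R) : f.totalDegree = ((degRevLex σ).degree f).degree := by
  by_cases hf : f = 0
  · simp [hf]
  refine le_antisymm ?_ ?_
  · rw [totalDegree]
    refine Finset.sup_le fun u hu => ?_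
    exact degree_le_of_toDegRevLex_le ((degRevLex σ).le_degree hu)
  · exact le_totalDegree ((degRevLex σ).degree_mem_support hf)

/-- The `y` variables come last, so the last `y` occurring in `w` is the last index where `u` and
`w` differ. -/
theorem toDegRevLex_lt_of_inr {c d : ℕ} {u w : Fin c ⊕ₗ Fin d →₀ ℕ} (h : w.degree = u.degree)
    (hu : ∀ j, u (toLex (Sum.inr j)) = 0) {j : Fin d} (hw : w (toLex (Sum.inr j)) ≠ 0) :
    toDegRevLex w < toDegRevLex u := by
  rw [toDegRevLex_lt_iff]
  refine Or.inr ⟨h, ?_⟩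
  obtain ⟨i, hi⟩ := (Finset.univ.filter fun j => w (toLex (Sum.inr j)) ≠ 0).exists_maximal
    ⟨j, by simpa using hw⟩
  have hi0 : w (toLex (Sum.inr i)) ≠ 0 := by simpa using hi.1
  refine ⟨toLex (Sum.inr i), fun v hv => ?_, ?_⟩
  · obtain ⟨v, rfl⟩ := toLex.surjective v
    rcases v with v | v
    · exact absurd hv (by simp)
    · rw [hu]
      by_contra hne
      have hv' : i < v := by simpa using hv
      exact absurd (hi.2 (by simpa using hne) hv'.le) (not_le.2 hv')
  · rw [hu]; omega

end DegRevLex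

/-! ### Minimal generators of the initial ideal -/

section Reducible

variable {c d : ℕ}

/-- The monomial with exponent `u` is the leading monomial of a binomial in the toric ideal. -/
def ToricReducible (α : ℕ) (a : Fin c → Fin d →₀ ℕ) (u : Fin c ⊕ₗ Fin d →₀ ℕ) : Prop :=
  ∃ w, toricExponent α a w = toricExponent α a u ∧ toDegRevLex w < toDegRevLex u

variable {α : ℕ} {a : Fin c → Fin d →₀ ℕ}

theorem ToricReducible.mono {u v : Fin c ⊕ₗ Fin d →₀ ℕ} (h : ToricReducible α a u)
    (huv : u ≤ v) : ToricReducible α a v := by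
  obtain ⟨w, hw, hlt⟩ := h
  obtain ⟨z, rfl⟩ := exists_add_of_le huv
  exact ⟨w + z, by rw [map_add, map_add, hw], (toDegRevLex_add_lt_add_iff _ _ _).2 hlt⟩

/-- The order is well-founded, so each fibre has a smallest monomial: the normal form of `u`. -/
theorem exists_toricExponent_eq_not_toricReducible (u : Fin c ⊕ₗ Fin d →₀ ℕ) :
    ∃ w, toricExponent α a w = toricExponent α a u ∧ ¬ ToricReducible α a w := by
  obtain ⟨m, hm, hmin⟩ := WellFounded.has_min
    (wellFounded_lt (α := DegRevLex (Fin c ⊕ₗ Fin d)))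
    {z | toricExponent α a (toDegRevLex.symm z) = toricExponent α a u}
    ⟨toDegRevLex u, by simp⟩
  refine ⟨toDegRevLex.symm m, hm, ?_⟩
  rintro ⟨w, hw, hlt⟩
  refine hmin (toDegRevLex w) ?_ (by simpa using hlt)
  simp only [Set.mem_ofPred_eq, Equiv.symm_apply_apply]
  exact hw.trans hm

/-- If every monomial of degree `r + 1` in the variables `x` has the same image as a monomial that
involves some `y`, then the `x`-part of an irreducible monomial has degree at most `r`. -/
theorem exists_toricReducible_le (hα : α ≠ 0) (ha : ∀ i, (a i).degree = α) {r : ℕ}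
    (hr : ∀ u : Fin c ⊕ₗ Fin d →₀ ℕ, u.degree = r + 1 →
      ∃ j w, toricExponent α a u = toricExponent α a w + Finsupp.single j α)
    {u : Fin c ⊕ₗ Fin d →₀ ℕ} (hu : r < (xPart u).degree) :
    ∃ w ≤ xPart u, w.degree = r + 1 ∧ ToricReducible α a w := by
  obtain ⟨w, hw, hdeg⟩ := (xPart u).exists_le_degree_eq _ hu
  refine ⟨w, hw, hdeg, ?_⟩
  obtain ⟨j, z, hz⟩ := hr w hdeg
  have he : toricExponent α a (z + Finsupp.single (toLex (Sum.inr j)) 1) =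
      toricExponent α a w := by
    rw [map_add, toricExponent_single_inr, one_smul, hz]
  refine ⟨_, he, toDegRevLex_lt_of_inr (degree_eq_of_toricExponent_eq hα ha he) (fun j' => ?_)
    (j := j) (by simp)⟩
  have := hw (toLex (Sum.inr j'))
  rw [xPart_inr] at this
  omega

theorem degree_le_of_minimal_toricReducible (hα : α ≠ 0) (ha : ∀ i, (a i).degree = α) {r : ℕ}
    (hr : ∀ u : Fin c ⊕ₗ Fin d →₀ ℕ, u.degree = r + 1 →
      ∃ j w, toricExponent α a u = toricExponent α a w + Finsupp.single j α)
    {u : Fin c ⊕ₗ Fin d →₀ ℕ} (hu : ToricReducible α a u)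
    (hmin : ∀ w ≤ u, ToricReducible α a w → w = u) :
    u.degree ≤ r + 1 ∨ u.degree + 1 ≤ 2 * r := by
  by_cases hx : r < (xPart u).degree
  · obtain ⟨w, hw, hdeg, hred⟩ := exists_toricReducible_le hα ha hr hx
    rw [← hmin w (hw.trans (xPart_le u)) hred]
    exact Or.inl hdeg.le
  by_cases hy : yPart u = 0
  · refine Or.inl ?_
    have := congrArg Finsupp.degree (xPart_add_yPart u)
    rw [hy, add_zero] at this
    omega
  refine Or.inr ?_
  obtain ⟨n, hn, hirr⟩ := exists_toricExponent_eq_not_toricReducible (α := α) (a := a) u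
  have hlt : toDegRevLex n < toDegRevLex u := by
    obtain ⟨w, hw, hwlt⟩ := hu
    by_contra hle
    exact hirr ⟨w, hw.trans hn.symm, hwlt.trans_le (not_lt.1 hle)⟩
  -- Cancelling a common variable would leave a reducible proper divisor of `u`.
  have hcop : ∀ v, n v = 0 ∨ u v = 0 := by
    intro v
    by_contra! h
    have h1 : Finsupp.single v 1 ≤ n := by
      rw [Finsupp.single_le_iff]; exact Nat.one_le_iff_ne_zero.2 h.1
    have h2 : Finsupp.single v 1 ≤ u := by
      rw [Finsupp.single_le_iff]; exact Nat.one_le_iff_ne_zero.2 h.2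
    obtain ⟨n', rfl⟩ := exists_add_of_le h1
    obtain ⟨u', rfl⟩ := exists_add_of_le h2
    rw [add_comm _ n', add_comm _ u'] at hlt hn
    have hred : ToricReducible α a u' := by
      refine ⟨n', ?_, (toDegRevLex_add_lt_add_iff _ _ _).1 hlt⟩
      rw [map_add, map_add] at hn
      exact add_right_cancel hn
    have := congrArg Finsupp.degree (hmin u' le_add_self hred)
    simp at this
  have hnx : (xPart n).degree ≤ r := by
    by_contra! h
    obtain ⟨w, hw, -, hred⟩ := exists_toricReducible_le hα ha hr h
    exact hirr (hred.mono (hw.trans (xPart_le n)))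
  -- If `y_j` divides `u` it does not divide `n`, so the whole power of `t_j` in the common image
  -- comes from `xPart n`.
  have hle : toricExponent α a (yPart u) ≤ toricExponent α a (xPart n) := by
    intro j
    rcases hcop (toLex (Sum.inr j)) with h | h
    · have h1 : toricExponent α a (yPart n) j = 0 := by
        rw [toricExponent_yPart_apply, h, zero_mul]
      have h2 := DFunLike.congr_fun hn j
      rw [← xPart_add_yPart n, ← xPart_add_yPart u, map_add, map_add, Finsupp.add_apply,
        Finsupp.add_apply, h1] at h2
      omega
    · rw [toricExponent_yPart_apply, h, zero_mul]
      exact Nat.zero_le _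
  have hyx : (yPart u).degree < (xPart n).degree := by
    have h1 : (yPart u).degree * α ≤ (xPart n).degree * α := by
      rw [← degree_toricExponent ha, ← degree_toricExponent ha]
      exact Finsupp.degree_mono hle
    -- Equal degrees would make the two images coincide; then `yPart u`, which involves a `y`, lies
    -- below `xPart n` in its fibre.
    refine lt_of_le_of_ne (Nat.le_of_mul_le_mul_right h1 (Nat.pos_of_ne_zero hα)) fun heq => ?_
    obtain ⟨z, hz⟩ := exists_add_of_le hle
    have hz0 : z.degree = 0 := by
      have := congrArg Finsupp.degree hz
      rw [map_add, degree_toricExponent ha, degree_toricExponent ha, heq] at this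
      omega
    rw [(Finsupp.degree_eq_zero_iff z).1 hz0, add_zero] at hz
    obtain ⟨v, hv⟩ := Finsupp.ne_iff.1 hy
    have hred : ToricReducible α a (xPart n) := by
      refine ⟨yPart u, hz.symm, ?_⟩
      obtain ⟨v, rfl⟩ := toLex.surjective v
      rcases v with i | j
      · exact absurd (by simp [yPart]) hv
      · exact toDegRevLex_lt_of_inr heq (xPart_inr n) hv
    exact hirr (hred.mono (xPart_le n))
  have := congrArg Finsupp.degree (xPart_add_yPart u)
  rw [map_add] at this
  omega

end Reducible

/-! ### From initial monomials to minimal Gröbner bases -/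

section Groebner

variable {K : Type*} [Field K] {c d α : ℕ} {a : Fin c → Fin d →₀ ℕ}

theorem toricMap_monomial (u : Fin c ⊕ₗ Fin d →₀ ℕ) (k : K) :
    toricMap K α a (monomial u k) = monomial (toricExponent α a u) k := by
  rw [toricMap, aeval_monomial, toricExponent, Finsupp.linearCombination_apply,
    monomial_finsupp_sum_index]
  simp [monomial_pow, MvPolynomial.algebraMap_eq]

/-- A term alone in its fibre could not cancel in the image. -/
theorem exists_support_toricExponent_eq {f : MvPolynomial (Fin c ⊕ₗ Fin d) K}
    (hf : f ∈ toricIdeal K α a) {u : Fin c ⊕ₗ Fin d →₀ ℕ} (hu : u ∈ f.support) :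
    ∃ w ∈ f.support, w ≠ u ∧ toricExponent α a w = toricExponent α a u := by
  by_contra! h
  have h0 : toricMap K α a f = 0 := hf
  rw [f.as_sum, map_sum] at h0
  have h1 := congrArg (coeff (toricExponent α a u)) h0
  simp only [toricMap_monomial, coeff_sum, coeff_monomial, coeff_zero] at h1
  rw [Finset.sum_eq_single_of_mem u hu (fun w hw hwu => if_neg (h w hw hwu)), if_pos rfl] at h1
  exact mem_support_iff.1 hu h1

theorem toricReducible_degree {f : MvPolynomial (Fin c ⊕ₗ Fin d) K}
    (hf : f ∈ toricIdeal K α a) (hf0 : f ≠ 0) :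
    ToricReducible α a ((degRevLex _).degree f) := by
  obtain ⟨w, hw, hne, he⟩ := exists_support_toricExponent_eq hf
    ((degRevLex _).degree_mem_support hf0)
  exact ⟨w, he, lt_of_le_of_ne ((degRevLex _).le_degree hw) fun h => hne (toDegRevLex.injective h)⟩

theorem ToricReducible.monomial_mem_initialIdeal {u : Fin c ⊕ₗ Fin d →₀ ℕ}
    (h : ToricReducible α a u) :
    monomial u (1 : K) ∈ initialIdeal (degRevLex _) (toricIdeal K α a) := by
  obtain ⟨w, he, hlt⟩ := h
  have hdeg : (degRevLex _).degree (monomial u (1 : K) - monomial w 1) = u := by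
    classical
    rw [MonomialOrder.degree_sub_of_lt]
    · rw [MonomialOrder.degree_monomial, if_neg one_ne_zero]
    · rw [MonomialOrder.degree_monomial, MonomialOrder.degree_monomial, if_neg one_ne_zero,
        if_neg one_ne_zero]
      exact hlt
  refine Ideal.subset_span ⟨monomial u 1 - monomial w 1, ?_, fun h0 => ?_, by rw [hdeg]⟩
  · change toricMap K α a _ = 0
    rw [map_sub, toricMap_monomial, toricMap_monomial, he, sub_self]
  · rw [sub_eq_zero] at h0
    exact hlt.ne (congrArg toDegRevLex (monomial_left_injective one_ne_zero h0)).symm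

theorem totalDegree_le_of_isMinimalGroebnerBasis (hα : α ≠ 0) (ha : ∀ i, (a i).degree = α) {r : ℕ}
    (hr : ∀ u : Fin c ⊕ₗ Fin d →₀ ℕ, u.degree = r + 1 →
      ∃ j w, toricExponent α a u = toricExponent α a w + Finsupp.single j α)
    {G : Set (MvPolynomial (Fin c ⊕ₗ Fin d) K)}
    (hG : IsMinimalGroebnerBasis (degRevLex _) (toricIdeal K α a) G)
    {g : MvPolynomial (Fin c ⊕ₗ Fin d) K} (hg : g ∈ G) :
    g.totalDegree ≤ r + 1 ∨ g.totalDegree + 1 ≤ 2 * r := by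
  obtain ⟨hGI, hG0, hspan, hmin⟩ := hG
  rw [totalDegree_eq_degree_degRevLex]
  refine degree_le_of_minimal_toricReducible hα ha hr
    (toricReducible_degree (hGI hg) fun h => hG0 (h ▸ hg)) fun w hw hred => ?_
  have hmem := hred.monomial_mem_initialIdeal (K := K)
  rw [← hspan] at hmem
  have hset : {p : MvPolynomial (Fin c ⊕ₗ Fin d) K | ∃ g ∈ G,
      p = monomial ((degRevLex _).degree g) 1} =
      (fun s => monomial s (1 : K)) '' ((degRevLex _).degree '' G) := by
    ext p; simp [eq_comm]
  rw [hset, mem_ideal_span_monomial_image] at hmem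
  -- Some leading monomial of `G` divides `w`, which divides that of `g`; minimality of `G` leaves
  -- only `g` itself.
  obtain ⟨_, ⟨g', hg', rfl⟩, hle⟩ := hmem w (by classical simp [mem_support_iff])
  by_cases hgg : g' = g
  · subst hgg; exact le_antisymm hw hle
  · exact absurd (hle.trans hw) (hmin g' hg' g hg hgg)

end Groebner

/-! ### Residues and quotients modulo `α` -/

section Residue

/-- The coordinatewise residue of an exponent vector modulo `α`. -/
noncomputable def expResidue {ι : Type*} (α : ℕ) (s : ι →₀ ℕ) : ι →₀ ℕ :=
  s.mapRange (· % α) (Nat.zero_mod α)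

/-- The coordinatewise quotient of an exponent vector by `α`. -/
noncomputable def expQuotient {ι : Type*} (α : ℕ) (s : ι →₀ ℕ) : ι →₀ ℕ :=
  s.mapRange (· / α) (Nat.zero_div α)

variable {ι : Type*} {α : ℕ}

theorem expResidue_apply (s : ι →₀ ℕ) (j : ι) : expResidue α s j = s j % α := by
  simp [expResidue]

theorem expResidue_add_smul_expQuotient (s : ι →₀ ℕ) :
    expResidue α s + α • expQuotient α s = s := by
  ext j
  simp [expResidue, expQuotient, Nat.mod_add_div]

theorem expResidue_add_smul (s z : ι →₀ ℕ) : expResidue α (s + α • z) = expResidue α s := by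
  ext j
  simp [expResidue]

theorem expResidue_eq_self {s : ι →₀ ℕ} (h : ∀ j, s j < α) : expResidue α s = s := by
  ext j
  rw [expResidue_apply, Nat.mod_eq_of_lt (h j)]

theorem exists_eq_add_smul {s t : ι →₀ ℕ} (h : expResidue α s = expResidue α t) (hst : s ≤ t) :
    ∃ z, t = s + α • z := by
  refine ⟨expQuotient α t - expQuotient α s, ?_⟩
  ext j
  have h1 := DFunLike.congr_fun h j
  have h2 : s j / α ≤ t j / α := Nat.div_le_div_right (hst j)
  rw [expResidue_apply, expResidue_apply] at h1
  simp only [expQuotient, Finsupp.add_apply, Finsupp.smul_apply, Finsupp.tsub_apply,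
    Finsupp.mapRange_apply, smul_eq_mul, Nat.mul_sub]
  have h3 := Nat.mod_add_div (s j) α
  have h4 := Nat.mod_add_div (t j) α
  have h5 := Nat.mul_le_mul_left α h2
  omega

end Residue

/-! ### Apéry elements and the number of residues -/

section Index

variable {c d : ℕ}

/-- The residues modulo `α` of the elements of the semigroup. -/
noncomputable def toricResidues (α : ℕ) (a : Fin c → Fin d →₀ ℕ) : Set (Fin d →₀ ℕ) :=
  Set.range fun u => expResidue α (toricExponent α a u)

/-- The image of the monomial with exponent `u` is not divisible by any `t_j ^ α` in the
semigroup ring. -/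
def IsToricApery (α : ℕ) (a : Fin c → Fin d →₀ ℕ) (u : Fin c ⊕ₗ Fin d →₀ ℕ) : Prop :=
  ∀ j w, toricExponent α a u ≠ toricExponent α a w + Finsupp.single j α

variable {α : ℕ} {a : Fin c → Fin d →₀ ℕ}

theorem finite_toricResidues (hα : α ≠ 0) : (toricResidues α a).Finite := by
  refine (Set.finite_Iic (Finsupp.equivFunOnFinite.symm fun _ => α)).subset ?_
  rintro _ ⟨u, rfl⟩ j
  simpa [expResidue] using (Nat.mod_lt _ (Nat.pos_of_ne_zero hα)).le

theorem exists_toricExponent_eq_smul (z : Fin d →₀ ℕ) : ∃ w, toricExponent α a w = α • z := by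
  induction z using Finsupp.induction_linear with
  | zero => exact ⟨0, by simp⟩
  | add u v hu hv =>
    obtain ⟨u', hu⟩ := hu
    obtain ⟨v', hv⟩ := hv
    exact ⟨u' + v', by rw [map_add, hu, hv, smul_add]⟩
  | single j n =>
    refine ⟨Finsupp.single (toLex (Sum.inr j)) n, ?_⟩
    rw [toricExponent_single_inr, Finsupp.smul_single, Finsupp.smul_single, smul_eq_mul,
      smul_eq_mul, mul_comm]

/-- `α • z` is a sum of `e_j`'s, so a nonzero `z` would allow one of them to be split off. -/
theorem IsToricApery.eq_zero {u w : Fin c ⊕ₗ Fin d →₀ ℕ} (h : IsToricApery α a u)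
    {z : Fin d →₀ ℕ} (hz : toricExponent α a u = toricExponent α a w + α • z) : z = 0 := by
  by_contra hne
  obtain ⟨j, hj⟩ := Finsupp.ne_iff.1 hne
  have h1 : Finsupp.single j 1 ≤ z := by
    rw [Finsupp.single_le_iff]; exact Nat.one_le_iff_ne_zero.2 hj
  obtain ⟨z', rfl⟩ := exists_add_of_le h1
  obtain ⟨w', hw'⟩ := exists_toricExponent_eq_smul (α := α) (a := a) z'
  refine h j (w + w') ?_
  rw [hz, map_add, hw', smul_add, Finsupp.smul_single, smul_eq_mul, mul_one]
  abel

theorem IsToricApery.of_add {u v : Fin c ⊕ₗ Fin d →₀ ℕ} (h : IsToricApery α a (u + v)) :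
    IsToricApery α a u := by
  intro j w hw
  refine h j (w + v) ?_
  rw [map_add, hw, map_add]
  abel

theorem lt_of_ne_single (ha : ∀ i, (a i).degree = α) (ha_ne : ∀ i j, a i ≠ Finsupp.single j α)
    (i : Fin c) (j : Fin d) : a i j < α := by
  refine lt_of_le_of_ne ((Finsupp.le_degree j (a i)).trans_eq (ha i)) fun h => ha_ne i j ?_
  have h1 : Finsupp.single j α ≤ a i := by rw [Finsupp.single_le_iff, h]
  obtain ⟨z, hz⟩ := exists_add_of_le h1
  have := congrArg Finsupp.degree hz
  rw [ha, map_add, Finsupp.degree_single] at this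
  rw [hz, (Finsupp.degree_eq_zero_iff z).1 (by omega), add_zero]

/-- Induction along a chain of divisors of `u`, all Apéry. The final disjunction keeps each
representative below the next chain element of the same residue: it either divides `u` or, like `0`
and the `a i`, is its own residue. -/
theorem exists_finset_toricResidues (hα : α ≠ 0) (ha : ∀ i, (a i).degree = α)
    (ha_inj : Function.Injective a) (ha_ne : ∀ i j, a i ≠ Finsupp.single j α) (n : ℕ)
    (u : Fin c ⊕ₗ Fin d →₀ ℕ) (hu : u.degree = n + 1) (hA : IsToricApery α a u) :
    ∃ F : Finset (Fin d →₀ ℕ), F.card = n + 1 + c ∧ ∀ b ∈ F, ∃ w, w.degree ≤ n + 1 ∧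
      expResidue α (toricExponent α a w) = b ∧
      (toricExponent α a w ≤ toricExponent α a u ∨ toricExponent α a w = b) := by
  classical
  induction n generalizing u with
  | zero =>
    refine ⟨insert 0 (Finset.univ.image a), ?_, ?_⟩
    · rw [Finset.card_insert_of_notMem, Finset.card_image_of_injective _ ha_inj]
      · simp [add_comm]
      · simp only [Finset.mem_image, Finset.mem_univ, true_and, not_exists]
        intro i h
        have := ha i
        rw [h, map_zero] at this
        exact hα this.symm
    · intro b hb
      rcases Finset.mem_insert.1 hb with rfl | hb
      · exact ⟨0, by simp, by ext; simp [expResidue], Or.inr (by simp)⟩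
      · obtain ⟨i, -, rfl⟩ := Finset.mem_image.1 hb
        have h1 : toricExponent α a (Finsupp.single (toLex (Sum.inl i)) 1) = a i := by
          rw [toricExponent_single_inl, one_smul]
        refine ⟨Finsupp.single (toLex (Sum.inl i)) 1, by simp, ?_, Or.inr h1⟩
        rw [h1]
        exact expResidue_eq_self (lt_of_ne_single ha ha_ne i)
  | succ n ih =>
    obtain ⟨u', hu'u, hu'⟩ := u.exists_le_degree_eq (n + 1) (by omega)
    obtain ⟨v, rfl⟩ := exists_add_of_le hu'u
    obtain ⟨F, hF, hFw⟩ := ih u' hu' hA.of_add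
    refine ⟨insert (expResidue α (toricExponent α a (u' + v))) F, ?_, ?_⟩
    · rw [Finset.card_insert_of_notMem, hF]
      · omega
      · intro hmem
        obtain ⟨w, hw, hres, hle⟩ := hFw _ hmem
        have hle' : toricExponent α a w ≤ toricExponent α a (u' + v) := by
          rcases hle with hle | hle
          · rw [map_add]; exact hle.trans le_self_add
          · rw [hle]
            exact le_self_add.trans_eq (expResidue_add_smul_expQuotient _)
        -- A repeated residue would force equal exponents by the Apéry property, although `w` has
        -- smaller degree than `u' + v`.
        obtain ⟨z, hz⟩ := exists_eq_add_smul hres hle'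
        have h0 := hA.eq_zero hz
        rw [h0, smul_zero, add_zero] at hz
        have := degree_eq_of_toricExponent_eq hα ha hz
        omega
    · intro b hb
      rcases Finset.mem_insert.1 hb with rfl | hb
      · exact ⟨u' + v, by omega, rfl, Or.inl le_rfl⟩
      · obtain ⟨w, hw, hres, hle⟩ := hFw _ hb
        refine ⟨w, by omega, hres, hle.imp_left fun h => h.trans ?_⟩
        rw [map_add]
        exact le_self_add

/-- The degree of an Apéry element plus the codimension is at most the index. -/
theorem IsToricApery.degree_add_le (hα : α ≠ 0) (ha : ∀ i, (a i).degree = α)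
    (ha_inj : Function.Injective a) (ha_ne : ∀ i j, a i ≠ Finsupp.single j α)
    {u : Fin c ⊕ₗ Fin d →₀ ℕ} (hA : IsToricApery α a u) (hu : u.degree ≠ 0) :
    u.degree + c ≤ (toricResidues α a).ncard := by
  obtain ⟨n, hn⟩ := Nat.exists_eq_succ_of_ne_zero hu
  obtain ⟨F, hF, hFw⟩ := exists_finset_toricResidues hα ha ha_inj ha_ne n u hn hA
  rw [hn, Nat.succ_eq_add_one, ← hF, ← Set.ncard_coe_finset]
  refine Set.ncard_le_ncard (fun b hb => ?_) (finite_toricResidues hα)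
  obtain ⟨w, -, hw, -⟩ := hFw b hb
  exact ⟨w, hw⟩

end Index

/-! ### The semigroup ring and its reduction number -/

section SemigroupRing

variable {K : Type*} [Field K] {c d α : ℕ} {a : Fin c → Fin d →₀ ℕ}

theorem semigroupRing_eq_range : semigroupRing K α a = (toricMap K α a).range := by
  rw [semigroupRing, toricMap, Algebra.adjoin_range_eq_range_aeval]

theorem monomial_toricExponent_mem (u : Fin c ⊕ₗ Fin d →₀ ℕ) (k : K) :
    monomial (toricExponent α a u) k ∈ semigroupRing K α a := by
  rw [semigroupRing_eq_range, ← toricMap_monomial]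
  exact ⟨_, rfl⟩

theorem mem_semigroupRing_iff {f : MvPolynomial (Fin d) K} :
    f ∈ semigroupRing K α a ↔ ∀ s ∈ f.support, ∃ u, toricExponent α a u = s := by
  constructor
  · rw [semigroupRing_eq_range]
    rintro ⟨p, rfl⟩ s hs
    change s ∈ (toricMap K α a p).support at hs
    rw [p.as_sum, map_sum] at hs
    classical
    obtain ⟨u, -, hu⟩ := Finset.mem_biUnion.1 (support_sum hs)
    rw [toricMap_monomial] at hu
    exact ⟨u, (Finset.mem_singleton.1 (support_monomial_subset hu)).symm⟩
  · intro h
    rw [f.as_sum]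
    refine sum_mem fun s hs => ?_
    obtain ⟨u, rfl⟩ := h s hs
    exact monomial_toricExponent_mem u _

theorem X_pow_mem_semigroupRing (j : Fin d) : X j ^ α ∈ semigroupRing K α a := by
  have := monomial_toricExponent_mem (K := K) (α := α) (a := a)
    (Finsupp.single (toLex (Sum.inr j)) 1) 1
  rwa [toricExponent_single_inr, one_smul, ← X_pow_eq_monomial] at this

theorem exists_of_mem_parameterIdeal {f : semigroupRing K α a} (hf : f ∈ parameterIdeal K α a) :
    ∀ s ∈ (f : MvPolynomial (Fin d) K).support,
      ∃ j w, s = toricExponent α a w + Finsupp.single j α := by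
  classical
  induction hf using Submodule.span_induction with
  | mem f hf =>
    obtain ⟨j, hj⟩ := hf
    intro s hs
    rw [hj, X_pow_eq_monomial] at hs
    exact ⟨j, 0, by rw [Finset.mem_singleton.1 (support_monomial_subset hs)]; simp⟩
  | zero => simp
  | add f g _ _ hf hg =>
    intro s hs
    rcases Finset.mem_union.1 (support_add hs) with hs | hs
    exacts [hf s hs, hg s hs]
  | smul p f _ hf =>
    intro s hs
    obtain ⟨t, ht, s, hs', rfl⟩ := Finset.mem_add.1 (support_mul _ _ hs)
    obtain ⟨u, rfl⟩ := mem_semigroupRing_iff.1 p.2 t ht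
    obtain ⟨j, w, rfl⟩ := hf s hs'
    exact ⟨j, u + w, by rw [map_add, add_assoc]⟩

theorem mem_parameterIdeal_of_support {f : semigroupRing K α a}
    (h : ∀ s ∈ (f : MvPolynomial (Fin d) K).support,
      ∃ j w, s = toricExponent α a w + Finsupp.single j α) :
    f ∈ parameterIdeal K α a := by
  have hmem : (f : MvPolynomial (Fin d) K) ∈
      ((parameterIdeal K α a).restrictScalars K).map (semigroupRing K α a).val.toLinearMap := by
    rw [(f : MvPolynomial (Fin d) K).as_sum]
    refine sum_mem fun s hs => ?_
    obtain ⟨j, w, rfl⟩ := h s hs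
    refine ⟨⟨_, monomial_toricExponent_mem w (coeff (toricExponent α a w + Finsupp.single j α)
      (f : MvPolynomial (Fin d) K))⟩ *
      ⟨X j ^ α, X_pow_mem_semigroupRing j⟩, ?_, ?_⟩
    · exact Ideal.mul_mem_left _ _ (Ideal.subset_span ⟨j, rfl⟩)
    · change monomial _ _ * X j ^ α = _
      rw [X_pow_eq_monomial, monomial_mul, mul_one]
  obtain ⟨g, hg, hgf⟩ := hmem
  rwa [← show g = f from Subtype.ext hgf]

/-- Both `K[S]` and the parameter ideal are spanned by monomials, so equality in degree `n` can be
tested on monomials. -/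
theorem parameterIdeal_inf_eq_iff (hα : α ≠ 0) (ha : ∀ i, (a i).degree = α) (n : ℕ) :
    (parameterIdeal K α a).restrictScalars K ⊓ semigroupRingPiece K α a n =
      semigroupRingPiece K α a n ↔
    ∀ u : Fin c ⊕ₗ Fin d →₀ ℕ, u.degree = n → ¬ IsToricApery α a u := by
  rw [inf_eq_right]
  constructor
  · intro h u hu hA
    have hmem : (⟨_, monomial_toricExponent_mem u 1⟩ : semigroupRing K α a) ∈
        semigroupRingPiece K α a n :=
      isHomogeneous_monomial _ (by rw [degree_toricExponent ha, hu, mul_comm])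
    obtain ⟨j, w, hw⟩ := exists_of_mem_parameterIdeal (h hmem) (toricExponent α a u)
      (by classical simp [mem_support_iff])
    exact hA j w hw
  · intro h f hf
    refine mem_parameterIdeal_of_support fun s hs => ?_
    obtain ⟨u, rfl⟩ := mem_semigroupRing_iff.1 f.2 s hs
    have hdeg : (toricExponent α a u).degree = α * n := by
      have hf' : IsHomogeneous (f : MvPolynomial (Fin d) K) (α * n) := hf
      rw [Finsupp.degree_eq_weight_one]
      exact hf' (mem_support_iff.1 hs)
    rw [degree_toricExponent ha, mul_comm] at hdeg
    have := h u (Nat.eq_of_mul_eq_mul_left (Nat.pos_of_ne_zero hα) hdeg)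
    simpa only [IsToricApery, ne_eq, not_forall, not_not] using this

theorem exists_isReductionNumber (hα : α ≠ 0) (ha : ∀ i, (a i).degree = α)
    (ha_inj : Function.Injective a) (ha_ne : ∀ i j, a i ≠ Finsupp.single j α) :
    ∃ r, IsReductionNumber (semigroupRingPiece K α a) (parameterIdeal K α a) r ∧
      (∀ u : Fin c ⊕ₗ Fin d →₀ ℕ, u.degree = r + 1 → ¬ IsToricApery α a u) ∧
      (r ≠ 0 → r + c ≤ (toricResidues α a).ncard) := by
  classical
  -- Apéry degrees are bounded by the number of residues, so the least such `n` exists.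
  have hex : ∃ n, ∀ u : Fin c ⊕ₗ Fin d →₀ ℕ, u.degree = n + 1 → ¬ IsToricApery α a u := by
    refine ⟨(toricResidues α a).ncard, fun u hu hA => ?_⟩
    have := hA.degree_add_le hα ha ha_inj ha_ne (by omega)
    omega
  refine ⟨Nat.find hex, ⟨?_, fun n hn => ?_⟩, Nat.find_spec hex, fun h0 => ?_⟩
  · exact (parameterIdeal_inf_eq_iff hα ha _).2 (Nat.find_spec hex)
  · exact Nat.find_min' hex ((parameterIdeal_inf_eq_iff hα ha _).1 hn)
  · obtain ⟨m, hm⟩ := Nat.exists_eq_succ_of_ne_zero h0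
    -- As `m = r - 1` fails the condition, there is an Apéry element of degree exactly `m + 1 = r`.
    have := Nat.find_min hex (m := m) (by omega)
    push Not at this
    obtain ⟨u, hu, hA⟩ := this
    rw [hm, Nat.succ_eq_add_one, ← hu]
    exact hA.degree_add_le hα ha ha_inj ha_ne (by omega)

end SemigroupRing

/-! ### Dimensions of the graded pieces -/

section Level

variable {c d : ℕ}

open Classical in
/-- The elements of the semigroup whose image has degree `n` in the semigroup ring. -/
noncomputable def toricLevel (α : ℕ) (a : Fin c → Fin d →₀ ℕ) (n : ℕ) : Finset (Fin d →₀ ℕ) :=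
  (Finset.univ.finsuppAntidiag (α * n)).filter fun s => ∃ u, toricExponent α a u = s

theorem degree_expResidue_add {ι : Type*} (α : ℕ) (s : ι →₀ ℕ) :
    (expResidue α s).degree + α * (expQuotient α s).degree = s.degree := by
  conv_rhs => rw [← expResidue_add_smul_expQuotient (α := α) s]
  rw [map_add, map_nsmul, smul_eq_mul]

theorem Finsupp.mem_finsuppAntidiag_univ_iff {ι : Type*} [Fintype ι] [DecidableEq ι] {s : ι →₀ ℕ}
    {n : ℕ} : s ∈ Finset.univ.finsuppAntidiag n ↔ s.degree = n := by
  simp [Finset.mem_finsuppAntidiag, Finsupp.degree_eq_sum]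

variable {α : ℕ} {a : Fin c → Fin d →₀ ℕ}

theorem mem_toricLevel {n : ℕ} {s : Fin d →₀ ℕ} :
    s ∈ toricLevel α a n ↔ s.degree = α * n ∧ ∃ u, toricExponent α a u = s := by
  classical
  rw [toricLevel, Finset.mem_filter, Finsupp.mem_finsuppAntidiag_univ_iff]

theorem map_semigroupRingPiece (K : Type*) [Field K] (n : ℕ) :
    (semigroupRingPiece K α a n).map (semigroupRing K α a).val.toLinearMap =
      restrictSupport K (toricLevel α a n : Set (Fin d →₀ ℕ)) := by
  ext f
  rw [mem_restrictSupport_iff]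
  constructor
  · rintro ⟨f, hf, rfl⟩ s hs
    have hf' : IsHomogeneous (f : MvPolynomial (Fin d) K) (α * n) := hf
    refine mem_toricLevel.2 ⟨?_, mem_semigroupRing_iff.1 f.2 s hs⟩
    rw [Finsupp.degree_eq_weight_one]
    exact hf' (mem_support_iff.1 hs)
  · intro h
    refine ⟨⟨f, mem_semigroupRing_iff.2 fun s hs => (mem_toricLevel.1 (h hs)).2⟩, ?_, rfl⟩
    intro s hs
    refine (DFunLike.congr_fun Finsupp.degree_eq_weight_one s).symm.trans ?_
    exact (mem_toricLevel.1 (h (mem_support_iff.2 hs))).1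

theorem finrank_semigroupRingPiece (K : Type*) [Field K] (n : ℕ) :
    Module.finrank K (semigroupRingPiece K α a n) = (toricLevel α a n).card := by
  rw [LinearEquiv.finrank_eq (Submodule.equivMapOfInjective _
      (show Function.Injective (semigroupRing K α a).val.toLinearMap from Subtype.val_injective) _),
    map_semigroupRingPiece, Module.finrank_eq_nat_card_basis (basisRestrictSupport K _)]
  simp

end Level

/-! ### Counting semigroup elements by residue class -/

section Count

variable {c k α : ℕ} {a : Fin c → Fin (k + 1) →₀ ℕ}

theorem card_finsuppAntidiag_univ (k n : ℕ) :
    ((Finset.univ : Finset (Fin (k + 1))).finsuppAntidiag n).card = (n + k).choose k := by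
  rw [Finset.card_finsuppAntidiag_nat_eq_choose, Finset.card_univ, Fintype.card_fin,
    show k + 1 + n - 1 = n + k by omega, Nat.choose_symm_add]

/-- Within a residue class the quotient by `α` determines the element, and its degree is fixed and
at most `n`. -/
theorem card_le_choose_of_expResidue_eq (hα : α ≠ 0) {T : Finset (Fin (k + 1) →₀ ℕ)} {n : ℕ}
    {b : Fin (k + 1) →₀ ℕ} (hT : ∀ s ∈ T, s.degree = α * n) (hb : ∀ s ∈ T, expResidue α s = b) :
    T.card ≤ (n + k).choose k := by
  have hcard : T.card ≤
      ((Finset.univ : Finset (Fin (k + 1))).finsuppAntidiag ((α * n - b.degree) / α)).card := by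
    refine Finset.card_le_card_of_injOn (expQuotient α) (fun s hs => ?_) fun s hs t ht hst => ?_
    · refine Finset.mem_coe.2 (Finsupp.mem_finsuppAntidiag_univ_iff.2 ?_)
      have h1 := degree_expResidue_add α s
      rw [hT s hs, hb s hs] at h1
      rw [← h1, Nat.add_sub_cancel_left, Nat.mul_div_cancel_left _ (Nat.pos_of_ne_zero hα)]
    · rw [← expResidue_add_smul_expQuotient (α := α) s, hb s hs, ← hb t ht, hst,
        expResidue_add_smul_expQuotient]
  refine hcard.trans ?_
  rw [card_finsuppAntidiag_univ]
  exact Nat.choose_le_choose _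
    (Nat.add_le_add_right (Nat.div_le_of_le_mul (Nat.sub_le _ _)) k)

theorem card_toricLevel_le (hα : α ≠ 0) (n : ℕ) :
    (toricLevel α a n).card ≤ (toricResidues α a).ncard * (n + k).choose k := by
  classical
  have hfin : (toricResidues α a).Finite := finite_toricResidues hα
  rw [Set.ncard_eq_toFinset_card _ hfin, ← smul_eq_mul]
  have hmaps : ∀ s ∈ toricLevel α a n, expResidue α s ∈ hfin.toFinset := by
    intro s hs
    obtain ⟨-, u, rfl⟩ := mem_toricLevel.1 hs
    exact hfin.mem_toFinset.2 ⟨u, rfl⟩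
  rw [Finset.card_eq_sum_card_fiberwise hmaps]
  refine Finset.sum_le_card_nsmul _ _ _ fun b _ => ?_
  exact card_le_choose_of_expResidue_eq hα
    (fun s hs => (mem_toricLevel.1 (Finset.mem_of_mem_filter s hs)).1)
    fun s hs => (Finset.mem_filter.1 hs).2

/-- Fix an element of `S` for each residue and let `n₀` be the largest degree of these. Adding `α •
z` of the complementary degree stays in `S` and in the class. -/
theorem exists_le_card_toricLevel (hα : α ≠ 0) (ha : ∀ i, (a i).degree = α) :
    ∃ n₀, ∀ n, (toricResidues α a).ncard * (n - n₀ + k).choose k ≤ (toricLevel α a n).card ∨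
      n < n₀ := by
  classical
  have hfin : (toricResidues α a).Finite := finite_toricResidues hα
  choose! w hw using fun b (hb : b ∈ toricResidues α a) => hb
  refine ⟨hfin.toFinset.sup fun b => (w b).degree, fun n => ?_⟩
  rw [or_iff_not_imp_right, not_lt]
  intro hn
  rw [Set.ncard_eq_toFinset_card _ hfin, ← smul_eq_mul]
  rw [Finset.card_eq_sum_card_fiberwise (s := toricLevel α a n) (f := expResidue α)
    (t := hfin.toFinset)]
  · refine Finset.card_nsmul_le_sum _ _ _ fun b hb => ?_
    have hbw : (w b).degree ≤ hfin.toFinset.sup fun b => (w b).degree :=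
      Finset.le_sup (f := fun b => (w b).degree) hb
    have hres := hw b (hfin.mem_toFinset.1 hb)
    have hmaps : Set.MapsTo (fun z => toricExponent α a (w b) + α • z)
        ((Finset.univ : Finset (Fin (k + 1))).finsuppAntidiag (n - (w b).degree))
        (((toricLevel α a n).filter
        fun s => expResidue α s = b : Finset _) : Set (Fin (k + 1) →₀ ℕ)) := by
      intro z hz
      have hz' : z.degree = n - (w b).degree := Finsupp.mem_finsuppAntidiag_univ_iff.1 hz
      refine Finset.mem_filter.2 ⟨mem_toricLevel.2 ⟨?_, ?_⟩, ?_⟩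
      · rw [map_add, degree_toricExponent ha, map_nsmul, hz', smul_eq_mul, mul_comm, ← mul_add]
        congr 1
        omega
      · obtain ⟨v, hv⟩ := exists_toricExponent_eq_smul (α := α) (a := a) z
        exact ⟨w b + v, by rw [map_add, hv]⟩
      · rw [expResidue_add_smul]
        exact hres
    refine le_trans ?_ (Finset.card_le_card_of_injOn _ hmaps fun y _ z _ h => ?_)
    · rw [card_finsuppAntidiag_univ]
      exact Nat.choose_le_choose _ (by omega)
    · ext j
      have := DFunLike.congr_fun h j
      simpa [hα] using this
  · intro s hs
    obtain ⟨-, u, rfl⟩ := mem_toricLevel.1 hs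
    exact hfin.mem_toFinset.2 ⟨u, rfl⟩

end Count

/-! ### The multiplicity as a limit -/

section Limit

theorem tendsto_factorial_mul_choose_div_pow {k : ℕ} {g : ℕ → ℕ} (hg : Tendsto g atTop atTop)
    (hg1 : Tendsto (fun n : ℕ => (g n : ℝ) / n) atTop (𝓝 1)) :
    Tendsto (fun n : ℕ => (k ! : ℝ) * ((g n).choose k : ℝ) / (n : ℝ) ^ k) atTop (𝓝 1) := by
  have hne : ∀ᶠ n : ℕ in atTop, ((n : ℝ) ^ k / k ! : ℝ) ≠ 0 := by
    filter_upwards [eventually_gt_atTop 0] with n hn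
    positivity
  have h1 := ((Asymptotics.isEquivalent_iff_tendsto_one hne).1 (isEquivalent_choose k)).comp hg
  have h2 := h1.mul (hg1.pow k)
  rw [one_pow, one_mul] at h2
  refine h2.congr' ?_
  filter_upwards [hg.eventually_gt_atTop 0, eventually_gt_atTop 0] with n hgn hn
  have h3 : (g n : ℝ) ≠ 0 := by positivity
  have h4 : (n : ℝ) ≠ 0 := by positivity
  have h5 : (k ! : ℝ) ≠ 0 := by positivity
  simp only [Function.comp_apply, Pi.div_apply, div_pow]
  field_simp

theorem tendsto_natCast_sub_add_div (m k : ℕ) :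
    Tendsto (fun n : ℕ => ((n - m + k : ℕ) : ℝ) / n) atTop (𝓝 1) := by
  have h : Tendsto (fun n : ℕ => 1 + ((k : ℝ) - m) / n) atTop (𝓝 (1 + 0)) :=
    tendsto_const_nhds.add (tendsto_const_div_atTop_nhds_zero_nat _)
  rw [add_zero] at h
  refine h.congr' ?_
  filter_upwards [eventually_ge_atTop m, eventually_gt_atTop 0] with n hn hn0
  have h4 : (n : ℝ) ≠ 0 := by positivity
  push_cast [Nat.cast_sub hn]
  field_simp
  ring

theorem tendsto_nat_sub_add (m k : ℕ) : Tendsto (fun n : ℕ => n - m + k) atTop atTop :=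
  tendsto_atTop_mono (fun _ => Nat.le_add_right _ _) (tendsto_sub_atTop_nat m)

theorem tendsto_card_toricLevel {c k α : ℕ} {a : Fin c → Fin (k + 1) →₀ ℕ} (hα : α ≠ 0)
    (ha : ∀ i, (a i).degree = α) :
    Tendsto (fun n : ℕ => (k ! : ℝ) * ((toricLevel α a n).card : ℝ) / (n : ℝ) ^ k) atTop
      (𝓝 (toricResidues α a).ncard) := by
  obtain ⟨n₀, hn₀⟩ := exists_le_card_toricLevel (a := a) hα ha
  have hlim : ∀ m : ℕ, Tendsto (fun n : ℕ => ((toricResidues α a).ncard : ℝ) *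
      ((k ! : ℝ) * ((n - m + k).choose k : ℝ) / (n : ℝ) ^ k)) atTop
      (𝓝 (toricResidues α a).ncard) := by
    intro m
    simpa using (tendsto_factorial_mul_choose_div_pow (k := k) (tendsto_nat_sub_add m k)
      (tendsto_natCast_sub_add_div m k)).const_mul ((toricResidues α a).ncard : ℝ)
  refine tendsto_of_tendsto_of_tendsto_of_le_of_le' (hlim n₀) (hlim 0) ?_ ?_
  · filter_upwards [eventually_ge_atTop n₀] with n hn
    have h := (hn₀ n).resolve_right (not_lt.2 hn)
    rw [← mul_div_assoc, mul_left_comm]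
    gcongr
    exact_mod_cast h
  · refine Eventually.of_forall fun n => ?_
    have h := card_toricLevel_le (a := a) hα n
    rw [← mul_div_assoc, mul_left_comm]
    gcongr
    exact_mod_cast h

end Limit

/-! ### Krull dimension and codimension -/

section KrullDim

/-- Lying over and going up lift chains of primes to `S`; incomparability keeps contracted chains
strict. -/
theorem ringKrullDim_eq_of_isIntegral {R S : Type*} [CommRing R] [CommRing S] [Algebra R S]
    [Algebra.IsIntegral R S] [FaithfulSMul R S] : ringKrullDim R = ringKrullDim S := by
  refine le_antisymm ?_ ?_
  · refine iSup_le fun l => ?_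
    have : Algebra.HasGoingUp R S := inferInstance
    obtain ⟨P, hP, hPl⟩ := Ideal.nonempty_primesOver (S := S) l.head.asIdeal
    obtain ⟨L, hL, -⟩ := Ideal.exists_ltSeries_of_hasGoingUp l P
    rw [← hL]
    exact le_iSup (fun p : LTSeries (PrimeSpectrum S) => (p.length : WithBot ℕ∞)) L
  · exact Order.krullDim_le_of_strictMono (PrimeSpectrum.comap (algebraMap R S))
      fun I J h => Ideal.IsIntegral.comap_lt_comap (R := R) h

variable {K : Type*} [Field K] {c d α : ℕ} {a : Fin c → Fin d →₀ ℕ}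

theorem isIntegral_semigroupRing (hα : α ≠ 0) :
    Algebra.IsIntegral (semigroupRing K α a) (MvPolynomial (Fin d) K) := by
  refine ⟨fun f => ?_⟩
  induction f using MvPolynomial.induction_on with
  | C k => exact isIntegral_algebraMap (x := algebraMap K (semigroupRing K α a) k)
  | add f g hf hg => exact hf.add hg
  | mul_X f j hf =>
    refine hf.mul (IsIntegral.of_pow (Nat.pos_of_ne_zero hα) ?_)
    exact isIntegral_algebraMap (x := (⟨X j ^ α, X_pow_mem_semigroupRing j⟩ : semigroupRing K α a))

theorem ringKrullDim_semigroupRing (hα : α ≠ 0) : ringKrullDim (semigroupRing K α a) = d := by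
  have := isIntegral_semigroupRing (K := K) (a := a) hα
  rw [ringKrullDim_eq_of_isIntegral (S := MvPolynomial (Fin d) K)]
  simp

theorem isCodimension_semigroupRing (hα : α ≠ 0) :
    IsCodimension (MvPolynomial (Fin c ⊕ₗ Fin d) K) (semigroupRing K α a) c := by
  rw [IsCodimension, ringKrullDim_semigroupRing hα, MvPolynomial.ringKrullDim_of_isNoetherianRing,
    show Nat.card (Fin c ⊕ₗ Fin d) = c + d from (Nat.card_sum (α := Fin c)).trans (by simp)]
  simp [add_comm]

end KrullDim

/-! ### The main theorem -/

theorem theorem1 {K : Type*} [Field K] {c d α : ℕ} (hc : 2 ≤ c) (hα : 2 ≤ α)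
    (a : Fin c → Fin d →₀ ℕ) (ha : ∀ i, (a i).degree = α)
    (ha_inj : Function.Injective a) (ha_ne : ∀ i j, a i ≠ Finsupp.single j α) :
    ∃ r e δ : ℕ,
      IsReductionNumber (semigroupRingPiece K α a) (parameterIdeal K α a) r ∧
      IsMultiplicity (semigroupRingPiece K α a) e ∧
      IsCodimension (MvPolynomial (Fin c ⊕ₗ Fin d) K) (semigroupRing K α a) δ ∧
      (∀ G : Set (MvPolynomial (Fin c ⊕ₗ Fin d) K),
        IsMinimalGroebnerBasis (degRevLex (Fin c ⊕ₗ Fin d)) (toricIdeal K α a) G →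
        ∀ g ∈ G, (g.totalDegree : ℤ) ≤ max ((r : ℤ) + 1) (2 * (r : ℤ) - 1)) ∧
      max ((r : ℤ) + 1) (2 * (r : ℤ) - 1) ≤ max 2 (2 * ((e : ℤ) - (δ : ℤ)) - 1) := by
  have hα0 : α ≠ 0 := by omega
  obtain ⟨r, hr, hA, hre⟩ := exists_isReductionNumber (K := K) hα0 ha ha_inj ha_ne
  refine ⟨r, (toricResidues α a).ncard, c, hr, ?_, isCodimension_semigroupRing hα0,
    fun G hG g hg => ?_, ?_⟩
  · obtain _ | k := d
    · have h0 : a ⟨0, by omega⟩ = 0 := Subsingleton.elim _ _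
      have := ha ⟨0, by omega⟩
      rw [h0, map_zero] at this
      exact absurd this.symm hα0
    · refine ⟨k, by rw [ringKrullDim_semigroupRing hα0]; simp, ?_⟩
      simp_rw [finrank_semigroupRingPiece]
      exact tendsto_card_toricLevel hα0 ha
  · have h := totalDegree_le_of_isMinimalGroebnerBasis hα0 ha (r := r) (fun u hu => by
      simpa only [IsToricApery, ne_eq, not_forall, not_not] using hA u hu) hG hg
    omega
  -- If `r = 0` the left side is `1`. If `r = 1` it is `2`. For `r ≥ 2` it is `2 * r - 1`, and `hre`
  -- gives `r ≤ e - c`.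
  · omega
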